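/- **Setting.** Let $n\ge 1$. A concept class over $\{0,1\}^n$ is a finite set $C$ of functions $c:\{0,1\}^n\to\{0,1\}$. For nonempty $S\subseteq C$ and $a\in\{0,1\}^n$ put $$\gamma_a^S=\min_{b\in\{0,1\}}\frac{|\{c\in S: c(a)=b\}|}{|S|},\qquad \gamma^S=\max_{a\in\{0,1\}^n}\gamma_a^S,\qquad \hat\gamma^C=\min_{S\subseteq C,\ |S|\ge 2}\gamma^S .$$ A partition $P$ of $C$ is a collection of nonempty pairwise disjoint subsets of $C$ with union $C$; $|P|$ is the number of its pieces. If $|P|\ge 2$, let $$\hat\gamma_P^C=\min_{S\in\mathscr S}\gamma^S,$$ where $\mathscr S$ is the family of all $S\subseteq C$ with $|S|\ge 2$ such that every $S'\subseteq S$ with $|S'|\ge\frac34|S|$ meets at least two pieces of $P$. An algorithm learns $P$ if, given black-box access to any unknown $c\in C$, it outputs the piece of $P$ containing $c$ with probability at least $2/3$. $R_P(C)$ is the least $T$ for which a randomized classical algorithm making at most $T$ membership queries learns $P$. $Q_P(C)$ is the least $T$ for which a quantum algorithm $U_0, O_c, U_1, O_c,\dots,O_c,U_T$ learns $P$; here $O_c|x,b,z\rangle=|x,b\oplus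 c(x),z\rangle$, with $z$ ranging over the basis states of a finite-dimensional workspace, the unitaries $U_i$ do not depend on $c$, the initial state is a fixed computational basis state, and the output is determined by measuring the final state in the computational basis. **Theorem.** There are absolute constants $K,\kappa>0$ such that for every $n\ge1$, every concept class $C$ over $\{0,1\}^n$ and every integer $k$ with $2\le k\le|C|$, there is a partition $P$ of $C$ with $|P|=k$ such that $$R_P(C)\le K\,n\,Q_P(C)^3 .$$ Moreover, the same $P$ can be chosen to satisfy all of the following: 1. $\hat\gamma_P^C=\hat\gamma^C$; 2. there is a deterministic classical algorithm which makes at most $K\,\dfrac{\log|P|}{\hat\gamma^C}$ queries and outputs the correct piece of $P$ for every $c\in C$; in particular $R_P(C)\le K\,\dfrac{\log|P|}{\hat\gamma^C}$; 3. $Q_P(C)\ \ge\ \kappa\left(\dfrac{\log|P|}{n}+\dfrac{1}{\sqrt{\hat\gamma^C}}\right)$. Here $\log$ is the natural logarithm (the choice of base only affects the constants). -/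

import Mathlib

namespace PartitionLearning

open Finset
open scoped ENNReal

/-! ### Concepts and the combinatorial parameters -/

/-- The domain `{0,1}^n`. -/
abbrev Input (n : ℕ) : Type := Fin n → Bool

/-- A concept over `{0,1}^n` is a Boolean function; a concept class is a finite set of them. -/
abbrev Concept (n : ℕ) : Type := Input n → Bool

noncomputable section

/-- `γ_a^S = min_{b ∈ {0,1}} |{c ∈ S : c(a) = b}| / |S|`. -/
def gammaAt {n : ℕ} (S : Finset (Concept n)) (a : Input n) : ℝ :=
  univ.inf' univ_nonempty fun b : Bool => (#{c ∈ S | c a = b} : ℝ) / (#S : ℝ)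

/-- `γ^S = max_a γ_a^S`. -/
def gamma {n : ℕ} (S : Finset (Concept n)) : ℝ :=
  univ.sup' univ_nonempty fun a : Input n => gammaAt S a

/-- `γ̂^C`, the minimum of `γ^S` over all `S ⊆ C` with at least two elements. The infimum is over a
finite set, which is nonempty as soon as `C` has at least two elements. -/
def gammaHat {n : ℕ} (C : Finset (Concept n)) : ℝ :=
  sInf (gamma '' {S : Finset (Concept n) | S ⊆ C ∧ 2 ≤ #S})

/-- The family of subsets `S ⊆ C` with at least two elements such that every `S' ⊆ S` with
`|S'| ≥ (3/4) |S|` meets at least two pieces of the partition `P`. -/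
def spreadSubsets {n : ℕ} {C : Finset (Concept n)} (P : Finpartition C) :
    Set (Finset (Concept n)) :=
  {S | S ⊆ C ∧ 2 ≤ #S ∧ ∀ S' ⊆ S, (3 / 4 : ℝ) * (#S : ℝ) ≤ (#S' : ℝ) →
    ∃ A ∈ P.parts, ∃ B ∈ P.parts, A ≠ B ∧ (A ∩ S').Nonempty ∧ (B ∩ S').Nonempty}

/-- `γ̂^C_P`, the minimum of `γ^S` over the family above. The infimum is over a finite set, which
is nonempty as soon as `P` has at least two pieces. -/
def gammaHatPart {n : ℕ} {C : Finset (Concept n)} (P : Finpartition C) : ℝ :=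
  sInf (gamma '' spreadSubsets P)

end

/-! ### Classical query algorithms -/

/-- A deterministic adaptive query algorithm (decision tree) with outputs in `α`: a node queries
the black box at an input and continues according to the answer. -/
inductive DecisionTree (n : ℕ) (α : Type) : Type
  | leaf (a : α) : DecisionTree n α
  | query (x : Input n) (onFalse onTrue : DecisionTree n α) : DecisionTree n α

namespace DecisionTree

/-- The worst-case number of queries. -/
def depth {n : ℕ} {α : Type} : DecisionTree n α → ℕ
  | leaf _ => 0
  | query _ l r => max l.depth r.depth + 1

/-- The output when the black box is the concept `c`. -/
def eval {n : ℕ} {α : Type} (c : Concept n) : DecisionTree n α → α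
  | leaf a => a
  | query x l r => bif c x then r.eval c else l.eval c

/-- The tree that reads the inputs in a list, records the answers in `g`, and outputs `f g`. -/
def readAll {n : ℕ} {α : Type} (f : Concept n → α) :
    List (Input n) → Concept n → DecisionTree n α
  | [], g => leaf (f g)
  | x :: l, g =>
      query x (readAll f l (Function.update g x false)) (readAll f l (Function.update g x true))

theorem eval_readAll {n : ℕ} {α : Type} (f : Concept n → α) (c : Concept n) (l : List (Input n))
    (g : Concept n) (h : ∀ x, x ∉ l → g x = c x) : (readAll f l g).eval c = f c := by
  induction l generalizing g with
  | nil =>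
    have : g = c := funext fun x => h x (by simp)
    simp [readAll, eval, this]
  | cons y l ih =>
    have key : ∀ b, c y = b → ∀ x, x ∉ l → Function.update g y b x = c x := by
      intro b hb x hx
      by_cases hxy : x = y
      · subst hxy
        simp [hb]
      · rw [Function.update_of_ne hxy]
        exact h x (by simp [hxy, hx])
    cases hc : c y
    · simpa [readAll, eval, hc] using ih _ (key false hc)
    · simpa [readAll, eval, hc] using ih _ (key true hc)

end DecisionTree

/-- There is a randomized classical algorithm (a probability distribution over decision trees)
which always makes at most `T` queries and which, for every target concept `c ∈ C`, outputs the
piece of `P` containing `c` with probability at least `2/3`. -/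
def RandomizedLearns {n : ℕ} {C : Finset (Concept n)} (P : Finpartition C) (T : ℕ) : Prop :=
  ∃ μ : PMF (DecisionTree n (Finset (Concept n))), (∀ t ∈ μ.support, t.depth ≤ T) ∧
    ∀ c ∈ C, (2 / 3 : ℝ≥0∞) ≤ (μ.map fun t => t.eval c) (P.part c)

/-- `R_P(C)`: the optimal randomized classical query complexity of learning `P`. -/
noncomputable def randomizedComplexity {n : ℕ} {C : Finset (Concept n)} (P : Finpartition C) : ℕ :=
  sInf {T | RandomizedLearns P T}

theorem exists_randomizedLearns {n : ℕ} {C : Finset (Concept n)} (P : Finpartition C) :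
    ∃ T, RandomizedLearns P T := by
  set t := DecisionTree.readAll (fun c => P.part c) (univ : Finset (Input n)).toList
    (fun _ => false)
  refine ⟨t.depth, PMF.pure t, ?_, ?_⟩
  · intro s hs
    rw [PMF.mem_support_pure_iff] at hs
    rw [hs]
  · intro c _
    have h : t.eval c = P.part c :=
      DecisionTree.eval_readAll (fun c => P.part c) c _ _ (by simp)
    rw [PMF.pure_map, h]
    simp only [PMF.pure_apply, if_true]
    exact ENNReal.div_le_of_le_mul (by norm_num)

/-! ### Quantum query algorithms -/

/-- Computational basis states `|x, b, z⟩`: query register, answer qubit, workspace. -/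
abbrev Basis (n w : ℕ) : Type := Input n × Bool × Fin w

/-- The matrix of the quantum membership oracle `|x, b, z⟩ ↦ |x, b ⊕ c(x), z⟩`. -/
def oracle {n : ℕ} (w : ℕ) (c : Concept n) : Matrix (Basis n w) (Basis n w) ℂ :=
  Matrix.of fun p q => if p = (q.1, xor q.2.1 (c q.1), q.2.2) then 1 else 0

/-- A quantum query algorithm `U_0, oracle, U_1, oracle, …, oracle, U_T` with `T = queries`,
started in a basis state. Its output is a function of the result of a measurement of the final
state in the computational basis. Only the unitaries `U i` with `i ≤ queries` are used. -/
structure QuantumAlgorithm (n : ℕ) (α : Type) where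
  /-- The dimension of the workspace. -/
  workspace : ℕ
  /-- The number of oracle calls. -/
  queries : ℕ
  /-- The initial basis state. -/
  start : Basis n workspace
  /-- The unitaries, which do not depend on the target concept. -/
  U : ℕ → Matrix.unitaryGroup (Basis n workspace) ℂ
  /-- The output, as a function of the measured basis state. -/
  output : Basis n workspace → α

namespace QuantumAlgorithm

/-- The state right after `U i` has been applied, when the target concept is `c`. -/
noncomputable def state {n : ℕ} {α : Type} (A : QuantumAlgorithm n α) (c : Concept n) :
    ℕ → Basis n A.workspace → ℂ
  | 0 => Matrix.mulVec (A.U 0 : Matrix _ _ ℂ) (Pi.single A.start 1)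
  | i + 1 => Matrix.mulVec (A.U (i + 1) : Matrix _ _ ℂ)
      (Matrix.mulVec (oracle A.workspace c) (A.state c i))

/-- The probability that the algorithm outputs `a` when the target concept is `c`. -/
noncomputable def outputProb {n : ℕ} {α : Type} [DecidableEq α] (A : QuantumAlgorithm n α) (c : Concept n)
    (a : α) : ℝ :=
  ∑ p with A.output p = a, ‖A.state c A.queries p‖ ^ 2

end QuantumAlgorithm

/-- There is a quantum algorithm with `T` oracle calls which, for every target concept `c ∈ C`,
outputs the piece of `P` containing `c` with probability at least `2/3`. -/
def QuantumLearns {n : ℕ} {C : Finset (Concept n)} (P : Finpartition C) (T : ℕ) : Prop :=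
  ∃ A : QuantumAlgorithm n (Finset (Concept n)), A.queries = T ∧
    ∀ c ∈ C, (2 / 3 : ℝ) ≤ A.outputProb c (P.part c)

/-- `Q_P(C)`: the optimal quantum query complexity of learning `P`. -/
noncomputable def quantumComplexity {n : ℕ} {C : Finset (Concept n)} (P : Finpartition C) : ℕ :=
  sInf {T | QuantumLearns P T}

/-! The set of which `quantumComplexity` is the infimum is nonempty: an algorithm may read the
whole truth table. -/

theorem mulVec_single_of_map {B : Type} [Fintype B] [DecidableEq B] (f : B → B) (q : B) :
    Matrix.mulVec (Matrix.of fun p q => if p = f q then (1 : ℂ) else 0) (Pi.single q 1) =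
      Pi.single (f q) 1 := by
  ext p
  simp [Pi.single_apply]

theorem of_perm_mem_unitaryGroup {B : Type} [Fintype B] [DecidableEq B] (σ : Equiv.Perm B) :
    (Matrix.of fun p q => if p = σ q then (1 : ℂ) else 0) ∈ Matrix.unitaryGroup B ℂ := by
  rw [Matrix.mem_unitaryGroup_iff']
  ext p q
  simp [Matrix.mul_apply, Matrix.one_apply, Matrix.star_apply, eq_comm]

/-- `|x, b, z⟩ ↦ |x, z(x), z[x ↦ b]⟩`, where the workspace holds a truth table through `e`. -/
def storePerm {n w : ℕ} (e : Concept n ≃ Fin w) : Equiv.Perm (Basis n w) :=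
  Function.Involutive.toPerm
    (fun p => (p.1, e.symm p.2.2 p.1, e (Function.update (e.symm p.2.2) p.1 p.2.1))) (by
      rintro ⟨x, b, z⟩
      simp)

theorem storePerm_apply {n w : ℕ} (e : Concept n ≃ Fin w) (x : Input n) (b : Bool) (z : Fin w) :
    storePerm e (x, b, z) = (x, e.symm z x, e (Function.update (e.symm z) x b)) :=
  rfl

theorem exists_quantumLearns {n : ℕ} {C : Finset (Concept n)} (P : Finpartition C) :
    ∃ T, QuantumLearns P T := by
  obtain ⟨w, ⟨e⟩⟩ := Finite.exists_equiv_fin (Concept n)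
  obtain ⟨N, ⟨idx⟩⟩ := Finite.exists_equiv_fin (Input n)
  let y : ℕ → Input n := fun i => if h : i < N then idx.symm ⟨i, h⟩ else fun _ => false
  let σ : ℕ → Equiv.Perm (Basis n w) := fun i => Nat.casesOn i 1 fun j =>
    (storePerm e).trans (Equiv.prodCongr (Equiv.swap (y j) (y (j + 1))) (Equiv.refl _))
  let A : QuantumAlgorithm n (Finset (Concept n)) :=
    { workspace := w
      queries := N
      start := (y 0, false, e fun _ => false)
      U := fun i => ⟨_, of_perm_mem_unitaryGroup (σ i)⟩
      output := fun p => P.part (e.symm p.2.2) }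
  have key : ∀ (c : Concept n) (i : ℕ), i ≤ N → A.state c i =
      Pi.single (y i, false, e fun x => if (idx x : ℕ) < i then c x else false) 1 := by
    intro c i
    induction i with
    | zero =>
      intro _
      rw [QuantumAlgorithm.state]
      refine (mulVec_single_of_map (σ 0) _).trans ?_
      simp [σ, A]
    | succ i ih =>
      intro hi
      have hi' : i < N := hi
      have hy : (idx (y i) : ℕ) = i := by simp [y, hi']
      rw [QuantumAlgorithm.state, ih hi'.le]
      have h1 := mulVec_single_of_map
        (fun q : Basis n w => (q.1, xor q.2.1 (c q.1), q.2.2))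
        (y i, false, e fun x => if (idx x : ℕ) < i then c x else false)
      refine (congrArg _ h1).trans ((mulVec_single_of_map (σ (i + 1)) _).trans ?_)
      congr 1
      simp only [σ, Equiv.trans_apply, storePerm_apply, Equiv.prodCongr_apply, Prod.map, Equiv.swap_apply_left, Equiv.symm_apply_apply,
        Equiv.refl_apply, hy, lt_irrefl, if_false, Bool.false_xor]
      congr 3
      ext x
      by_cases hx : x = y i
      · subst hx
        simp [hy]
      · have hne : (idx x : ℕ) ≠ i := fun h => hx (idx.injective (Fin.ext (h.trans hy.symm)))
        rw [Function.update_of_ne hx]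
        by_cases hlt : (idx x : ℕ) < i
        · simp [hlt, Nat.lt_succ_of_lt hlt]
        · simp [hlt, show ¬ (idx x : ℕ) < i + 1 by omega]
  refine ⟨N, A, rfl, fun c _ => ?_⟩
  have hfin : A.state c A.queries = Pi.single (y N, false, e c) 1 := by
    have h := key c N le_rfl
    simpa using h
  have hmem : ((y N, false, e c) : Basis n w) ∈
      ({p | A.output p = P.part c} : Finset (Basis n A.workspace)) := by
    simp [A]
  have hle : _ ≤ A.outputProb c (P.part c) := Finset.single_le_sum (f := fun p => ‖A.state c A.queries p‖ ^ 2)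
    (fun p _ => by positivity) hmem
  refine le_trans ?_ hle
  rw [hfin]
  simp
  norm_num

end PartitionLearning

/-!
Write `γ` for `gammaHat C` and fix a set `S ⊆ C` with at least two elements and `gamma S = γ`.
Whenever at least two concepts of `C` survive, some query eliminates a fraction at least `γ` of the
survivors, whatever its answer. With `D = ⌈log k / γ⌉`, so that `(1 - γ) ^ D ≤ 1 / k`, this is used
twice.

* Following only the majority answers inside `S` for `D` queries, and stopping when fewer than
  `3 / 4 * #S` concepts survive, gives a tree that divides `S` into two parts, each of relative size
  less than `3 / 4` (`exists_tree_balanced_split`).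
* Querying greedily inside `C` for `D` queries gives a tree each of whose leaves holds at most
  `#C / k` concepts, so at least `k` leaves are reached (`exists_tree_card_eval_le`).

The pairs of outputs of the two trees take at least `k` values. They are merged to exactly `k`
labels without merging the two sides of the first tree, and the pieces of `P` are the fibres of the
label (`exists_finpartition_spread_tree`). The composed tree learns `P` with
`2 * D ≤ 4 * log k / γ` queries, and no three quarters of `S` lie in a single piece, which gives
`gammaHatPart P = γ`.

Two lower bounds hold for a quantum algorithm with `T` queries. By the hybrid argument, comparing
the run on a member of `S` with the run on the majority vote of `S`, the final states of three
quarters of `S` are close to each other unless `T ^ 2 * γ ≥ 1 / 1600`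
(`QuantumLearns.le_sq_mul_gamma`). And since the final states lie in a space of dimension at most
`(2 ^ (n + 1)) ^ T`, they can identify at most about that many pieces
(`QuantumLearns.card_parts_le`). Multiplying the bounds for `log k` and `1 / γ` turns the classical
upper bound `4 * log k / γ` into `K * n * T ^ 3`.
-/

namespace PartitionLearning

open Finset
open scoped ENNReal

/-! ### Splitting parameters -/

theorem gammaAt_le {n : ℕ} (S : Finset (Concept n)) (a : Input n) (b : Bool) :
    gammaAt S a ≤ (#{c ∈ S | c a = b} : ℝ) / (#S : ℝ) :=
  inf'_le _ (mem_univ b)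

theorem card_filter_eq_add_card_filter_eq_not {n : ℕ} (S : Finset (Concept n)) (a : Input n)
    (b : Bool) : (#{c ∈ S | c a = b} : ℝ) + #{c ∈ S | c a = !b} = #S := by
  rw [← card_filter_add_card_filter_not (s := S) (fun c : Concept n => c a = b)]
  push_cast
  congr 3
  ext c
  cases b <;> simp

/-- Each answer to the query `a` eliminates at least a `gammaAt S a` fraction of `S`. -/
theorem card_filter_le_of_le_gammaAt {n : ℕ} {S : Finset (Concept n)} {a : Input n} {γ : ℝ}
    (hS : S.Nonempty) (h : γ ≤ gammaAt S a) (b : Bool) :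
    (#{c ∈ S | c a = b} : ℝ) ≤ (1 - γ) * #S := by
  have hS' : (0 : ℝ) < #S := by exact_mod_cast hS.card_pos
  have h1 := h.trans (gammaAt_le S a (!b))
  rw [le_div_iff₀ hS'] at h1
  have h2 := card_filter_eq_add_card_filter_eq_not S a b
  linarith

theorem gammaAt_le_half {n : ℕ} (S : Finset (Concept n)) (a : Input n) : gammaAt S a ≤ 1 / 2 := by
  rcases S.eq_empty_or_nonempty with rfl | hS
  -- for empty `S` the fractions are `0 / 0 = 0`
  · refine (gammaAt_le _ a true).trans ?_
    simp
  have hS' : (0 : ℝ) < #S := by exact_mod_cast hS.card_pos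
  have h1 := gammaAt_le S a true
  have h2 := gammaAt_le S a false
  rw [le_div_iff₀ hS'] at h1 h2
  have h3 := card_filter_eq_add_card_filter_eq_not S a true
  simp only [Bool.not_true] at h3
  by_contra! h
  nlinarith

theorem gammaAt_le_gamma {n : ℕ} (S : Finset (Concept n)) (a : Input n) :
    gammaAt S a ≤ gamma S :=
  le_sup' (gammaAt S) (mem_univ a)

theorem exists_gammaAt_eq_gamma {n : ℕ} (S : Finset (Concept n)) :
    ∃ a, gammaAt S a = gamma S := by
  obtain ⟨a, -, ha⟩ := exists_mem_eq_sup' (univ_nonempty (α := Input n)) (gammaAt S)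
  exact ⟨a, ha.symm⟩

theorem gamma_le_half {n : ℕ} (S : Finset (Concept n)) : gamma S ≤ 1 / 2 :=
  sup'_le _ _ fun a _ => gammaAt_le_half S a

theorem gamma_pos {n : ℕ} {S : Finset (Concept n)} (hS : 2 ≤ #S) : 0 < gamma S := by
  obtain ⟨c, hc, d, hd, hcd⟩ := one_lt_card.mp hS
  obtain ⟨a, ha⟩ := Function.ne_iff.mp hcd
  refine lt_of_lt_of_le ?_ (gammaAt_le_gamma S a)
  rw [gammaAt, lt_inf'_iff]
  intro b _
  have hS' : (0 : ℝ) < #S := by exact_mod_cast (by omega : 0 < #S)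
  refine div_pos ?_ hS'
  rw [Nat.cast_pos, card_pos]
  by_cases hb : c a = b
  · exact ⟨c, by simp [hc, hb]⟩
  · refine ⟨d, ?_⟩
    rw [mem_filter]
    refine ⟨hd, ?_⟩
    cases h1 : c a <;> cases h2 : d a <;> cases b <;> simp_all

theorem finite_gamma_image {n : ℕ} (F : Set (Finset (Concept n))) : (gamma '' F).Finite :=
  F.toFinite.image _

theorem gammaHat_le {n : ℕ} {C S : Finset (Concept n)} (hS : S ⊆ C) (h2 : 2 ≤ #S) :
    gammaHat C ≤ gamma S :=
  csInf_le (finite_gamma_image _).bddBelow ⟨S, ⟨hS, h2⟩, rfl⟩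

theorem exists_gamma_eq_gammaHat {n : ℕ} {C : Finset (Concept n)} (hC : 2 ≤ #C) :
    ∃ S ⊆ C, 2 ≤ #S ∧ gamma S = gammaHat C := by
  have hne : (gamma '' {S : Finset (Concept n) | S ⊆ C ∧ 2 ≤ #S}).Nonempty :=
    ⟨_, C, ⟨subset_rfl, hC⟩, rfl⟩
  obtain ⟨S, ⟨hS, h2⟩, h⟩ := hne.csInf_mem (finite_gamma_image _)
  exact ⟨S, hS, h2, h⟩

theorem exists_gammaHat_le_gammaAt {n : ℕ} {C U : Finset (Concept n)} (hU : U ⊆ C)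
    (h2 : 2 ≤ #U) : ∃ a, gammaHat C ≤ gammaAt U a := by
  obtain ⟨a, ha⟩ := exists_gammaAt_eq_gamma U
  exact ⟨a, ha ▸ gammaHat_le hU h2⟩

theorem gammaHatPart_eq_gammaHat {n : ℕ} {C S : Finset (Concept n)} {P : Finpartition C}
    (hS : S ∈ spreadSubsets P) (h : gamma S = gammaHat C) : gammaHatPart P = gammaHat C := by
  refine le_antisymm (h ▸ csInf_le (finite_gamma_image _).bddBelow ⟨S, hS, rfl⟩) ?_
  refine csInf_le_csInf (finite_gamma_image _).bddBelow ⟨_, S, hS, rfl⟩ ?_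
  exact Set.image_mono fun U hU => ⟨hU.1, hU.2.1⟩

/-! ### Decision trees -/

namespace DecisionTree

/-- Sequential composition: run `t`, then the tree that `f` assigns to its output. -/
def bind {n : ℕ} {α β : Type} (f : α → DecisionTree n β) : DecisionTree n α → DecisionTree n β
  | leaf a => f a
  | query x l r => query x (l.bind f) (r.bind f)

theorem eval_bind {n : ℕ} {α β : Type} (f : α → DecisionTree n β) (c : Concept n)
    (t : DecisionTree n α) : (t.bind f).eval c = (f (t.eval c)).eval c := by
  induction t with
  | leaf a => rfl
  | query x l r ihl ihr => cases h : c x <;> simp [bind, eval, h, ihl, ihr]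

theorem depth_bind_le {n : ℕ} {α β : Type} {f : α → DecisionTree n β} {d : ℕ}
    (hf : ∀ a, (f a).depth ≤ d) (t : DecisionTree n α) : (t.bind f).depth ≤ t.depth + d := by
  induction t with
  | leaf a => simpa [bind, depth] using hf a
  | query x l r ihl ihr =>
    simp only [bind, depth]
    omega

end DecisionTree

/-- Greedy halving: repeatedly querying a point that splits the surviving set `S` well leaves,
after `D` queries, a set which is a singleton or has size at most `(1 - γ) ^ D * #S`. The output
of the tree is the set of survivors. -/
theorem exists_tree_card_eval_le {n : ℕ} {γ : ℝ} (hγ : γ ≤ 1) (D : ℕ) (S : Finset (Concept n))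
    (h : ∀ U ⊆ S, 2 ≤ #U → ∃ a, γ ≤ gammaAt U a) :
    ∃ t : DecisionTree n (Finset (Concept n)), t.depth ≤ D ∧
      ∀ c ∈ S, c ∈ t.eval c ∧ (#(t.eval c) : ℝ) ≤ max 1 ((1 - γ) ^ D * #S) := by
  induction D generalizing S with
  | zero => exact ⟨.leaf S, le_rfl, fun c hc => ⟨hc, by simp [DecisionTree.eval]⟩⟩
  | succ D ih =>
    by_cases hS : 2 ≤ #S
    · obtain ⟨a, ha⟩ := h S subset_rfl hS
      have key : ∀ b : Bool, ∃ t : DecisionTree n (Finset (Concept n)), t.depth ≤ D ∧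
          ∀ c ∈ S, c a = b → c ∈ t.eval c ∧ (#(t.eval c) : ℝ) ≤
            max 1 ((1 - γ) ^ (D + 1) * #S) := by
        intro b
        obtain ⟨t, ht, hc⟩ := ih {c ∈ S | c a = b} fun U hU =>
          h U (hU.trans (filter_subset _ _))
        refine ⟨t, ht, fun c hcS hcb => ?_⟩
        have h1 := hc c (by simp [hcS, hcb])
        refine ⟨h1.1, h1.2.trans (max_le_max le_rfl ?_)⟩
        rw [pow_succ, mul_assoc]
        have h2 := card_filter_le_of_le_gammaAt (card_pos.mp (by omega)) ha b
        exact mul_le_mul_of_nonneg_left h2 (pow_nonneg (by linarith) _)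
      obtain ⟨l, hl, hl'⟩ := key false
      obtain ⟨r, hr, hr'⟩ := key true
      refine ⟨.query a l r, by simp only [DecisionTree.depth]; omega, fun c hc => ?_⟩
      cases hca : c a
      · simpa [DecisionTree.eval, hca] using hl' c hc hca
      · simpa [DecisionTree.eval, hca] using hr' c hc hca
    · refine ⟨.leaf S, by simp [DecisionTree.depth], fun c hc => ⟨hc, ?_⟩⟩
      refine le_max_of_le_left ?_
      exact_mod_cast (by omega : #S ≤ 1)

/-- Following the majority answer only, the survivors of `S` shrink by a factor between `1 / 2` and
`1 - γ` at each step, so that the first time their number falls below `3 / 4 * #S` it is still at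
least `3 / 8 * #S`. The tree outputs `true` on the survivors. -/
theorem exists_tree_majority_path {n : ℕ} {γ : ℝ} (L : ℕ) {S : Finset (Concept n)}
    (hS : 2 ≤ #S) (h : ∀ U ⊆ S, 2 ≤ #U → ∃ a, γ ≤ gammaAt U a) :
    ∃ t : DecisionTree n Bool, t.depth ≤ L ∧
      (3 / 8 : ℝ) * #S ≤ #{c ∈ S | t.eval c = true} ∧
      ((#{c ∈ S | t.eval c = true} : ℝ) < (3 / 4 : ℝ) * #S ∨
        (3 / 4 : ℝ) * #S ≤ #{c ∈ S | t.eval c = true} ∧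
          (#{c ∈ S | t.eval c = true} : ℝ) ≤ (1 - γ) ^ L * #S) := by
  induction L with
  | zero =>
    refine ⟨.leaf true, le_rfl, ?_, Or.inr ⟨?_, ?_⟩⟩ <;> simp [DecisionTree.eval] <;>
      linarith [Nat.cast_nonneg (α := ℝ) #S]
  | succ L ih =>
    obtain ⟨t, ht, hlow, hlt | ⟨hge, hle⟩⟩ := ih
    · exact ⟨t, by omega, hlow, Or.inl hlt⟩
    set U := {c ∈ S | t.eval c = true} with hU
    have hS2 : (2 : ℝ) ≤ #S := by exact_mod_cast hS
    have hU2 : 2 ≤ #U := by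
      have : (1 : ℝ) < #U := by linarith
      exact_mod_cast this
    obtain ⟨a, ha⟩ := h U (filter_subset _ _) hU2
    have hUne : U.Nonempty := card_pos.mp (by omega)
    have hγ : γ ≤ 1 / 2 := ha.trans (gammaAt_le_half U a)
    obtain ⟨b, hb⟩ : ∃ b : Bool, (#U : ℝ) / 2 ≤ #{c ∈ U | c a = b} := by
      have h1 := card_filter_eq_add_card_filter_eq_not U a true
      by_contra! hcon
      have h2 := hcon true
      have h3 := hcon false
      simp only [Bool.not_true] at h1
      linarith
    have hb' := card_filter_le_of_le_gammaAt hUne ha b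
    refine ⟨.query a (bif b then .leaf false else t) (bif b then t else .leaf false), ?_, ?_⟩
    · cases b <;> simpa [DecisionTree.depth] using ht
    have heq : {c ∈ S | (DecisionTree.query a (bif b then .leaf false else t)
        (bif b then t else .leaf false)).eval c = true} = {c ∈ U | c a = b} := by
      ext c
      cases b <;> cases hca : c a <;> simp [hU, DecisionTree.eval, hca]
    rw [heq]
    have hup : (#{c ∈ U | c a = b} : ℝ) ≤ (1 - γ) ^ (L + 1) * #S := by
      refine hb'.trans ?_
      rw [pow_succ', mul_assoc]
      exact mul_le_mul_of_nonneg_left hle (by linarith)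
    refine ⟨by linarith, ?_⟩
    rcases lt_or_ge (#{c ∈ U | c a = b} : ℝ) ((3 / 4 : ℝ) * #S) with h1 | h1
    · exact Or.inl h1
    · exact Or.inr ⟨h1, hup⟩

theorem exists_tree_balanced_split {n : ℕ} {γ : ℝ} {L : ℕ} {S : Finset (Concept n)}
    (hS : 2 ≤ #S) (h : ∀ U ⊆ S, 2 ≤ #U → ∃ a, γ ≤ gammaAt U a) (hL : (1 - γ) ^ L ≤ 1 / 2) :
    ∃ t : DecisionTree n Bool, t.depth ≤ L ∧
      ∀ b, (#{c ∈ S | t.eval c = b} : ℝ) < (3 / 4 : ℝ) * #S := by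
  obtain ⟨t, ht, hlow, hup⟩ := exists_tree_majority_path L hS h
  have hS2 : (2 : ℝ) ≤ #S := by exact_mod_cast hS
  have htrue : (#{c ∈ S | t.eval c = true} : ℝ) < (3 / 4 : ℝ) * #S := by
    rcases hup with h1 | ⟨h1, h2⟩
    · exact h1
    · nlinarith
  refine ⟨t, ht, fun b => ?_⟩
  cases b
  · have h1 := card_filter_add_card_filter_not (s := S) (fun c : Concept n => t.eval c = true)
    have h2 : ((#{c ∈ S | t.eval c = true} + #{c ∈ S | ¬ t.eval c = true} : ℕ) : ℝ) = #S := by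
      rw [h1]
    simp only [Bool.not_eq_true] at h2
    push_cast at h2
    linarith
  · exact htrue

/-! ### Partitions into fibres -/

/-- The labels can be merged so that exactly `k` remain while labels of different colour `p` stay
apart. -/
theorem exists_merge {α : Type} [DecidableEq α] {I : Finset α} {k : ℕ} (hk : 2 ≤ k) (hI : k ≤ #I)
    (p : α → Bool) (hp : ∀ b, ∃ i ∈ I, p i = b) :
    ∃ g : α → α, (∀ i, p (g i) = p i) ∧ #(I.image g) = k := by
  choose r hrI hr using hp
  obtain ⟨J, hrJ, hJI, hJ⟩ := exists_subsuperset_card_eq (s := univ.image r) (t := I) (n := k)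
    (by intro x hx; obtain ⟨b, -, rfl⟩ := mem_image.mp hx; exact hrI b)
    (card_image_le.trans (by simpa using hk)) hI
  refine ⟨fun i => if i ∈ J then i else r (p i), fun i => ?_, ?_⟩
  · by_cases h : i ∈ J <;> simp [h, hr]
  · convert hJ
    ext x
    rw [mem_image]
    constructor
    · rintro ⟨i, -, rfl⟩
      by_cases h : i ∈ J
      · simp [h]
      · simpa [h] using hrJ (mem_image_of_mem r (mem_univ _))
    · intro hx
      exact ⟨x, hJI hx, by simp [hx]⟩

theorem exists_finpartition_fibers {α β : Type} [DecidableEq α] [DecidableEq β] (C : Finset α)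
    (h : α → β) : ∃ P : Finpartition C, #P.parts = #(C.image h) ∧
      ∀ c ∈ C, P.part c = {d ∈ C | h d = h c} := by
  refine ⟨.ofExistsUnique ((C.image h).image fun j => {d ∈ C | h d = j}) ?_ ?_ ?_, ?_, ?_⟩
  · intro p hp
    obtain ⟨j, -, rfl⟩ := mem_image.mp hp
    exact filter_subset _ _
  · intro c hc
    refine ⟨{d ∈ C | h d = h c}, ⟨mem_image_of_mem _ (mem_image_of_mem h hc), by simp [hc]⟩, ?_⟩
    rintro t ⟨ht, hct⟩
    obtain ⟨j, -, rfl⟩ := mem_image.mp ht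
    rw [(mem_filter.mp hct).2]
  · intro h0
    obtain ⟨j, hj, h1⟩ := mem_image.mp h0
    obtain ⟨c, hc, rfl⟩ := mem_image.mp hj
    exact notMem_empty c (h1 ▸ mem_filter.mpr ⟨hc, rfl⟩)
  · refine card_image_of_injOn ?_
    intro i hi j _ hij
    obtain ⟨c, hc, rfl⟩ := mem_image.mp (mem_coe.mp hi)
    have hcj := (Finset.ext_iff.mp hij c).mp (mem_filter.mpr ⟨hc, rfl⟩)
    exact (mem_filter.mp hcj).2
  · intro c hc
    refine Finpartition.part_eq_of_mem _ ?_ (mem_filter.mpr ⟨hc, rfl⟩)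
    exact mem_image_of_mem (fun j => {d ∈ C | h d = j}) (mem_image_of_mem h hc)

/-- If the outputs of a tree, refined by a two-colouring that divides `S` into two parts of
relative size less than `3 / 4`, take at least `k` values, then there is a partition with `k`
pieces which the tree learns and for which `S` is spread. -/
theorem exists_finpartition_of_tree {n : ℕ} {β : Type} [DecidableEq β]
    {C S : Finset (Concept n)} {k : ℕ} (hk : 2 ≤ k) (hSC : S ⊆ C) (hS : 2 ≤ #S)
    (t : DecisionTree n β) (p : β → Bool)
    (hp : ∀ b, (#{c ∈ S | p (t.eval c) = b} : ℝ) < (3 / 4 : ℝ) * #S)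
    (ht : k ≤ #(C.image fun c => t.eval c)) :
    ∃ P : Finpartition C, #P.parts = k ∧ S ∈ spreadSubsets P ∧
      ∃ t' : DecisionTree n (Finset (Concept n)), t'.depth ≤ t.depth ∧
        ∀ c ∈ C, t'.eval c = P.part c := by
  have hmeet : ∀ S' ⊆ S, (3 / 4 : ℝ) * #S ≤ #S' → ∀ b, ∃ c ∈ S', p (t.eval c) = b := by
    intro S' hS' hcard b
    by_contra! hcon
    have hsub : S' ⊆ {c ∈ S | p (t.eval c) = !b} := by
      intro c hc
      rw [mem_filter]
      refine ⟨hS' hc, ?_⟩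
      have := hcon c hc
      cases b <;> simpa using this
    have h1 : (#S' : ℝ) ≤ #{c ∈ S | p (t.eval c) = !b} := by exact_mod_cast card_le_card hsub
    linarith [hp (!b)]
  obtain ⟨g, hgp, hg⟩ := exists_merge hk ht p (by
    intro b
    obtain ⟨c, hc, hcb⟩ := hmeet S subset_rfl (by linarith [Nat.cast_nonneg (α := ℝ) #S]) b
    exact ⟨_, mem_image_of_mem _ (hSC hc), hcb⟩)
  rw [image_image] at hg
  obtain ⟨P, hPcard, hP⟩ := exists_finpartition_fibers C (g ∘ fun c => t.eval c)
  refine ⟨P, hPcard.trans hg, ⟨hSC, hS, ?_⟩, t.bind fun j => .leaf {d ∈ C | g (t.eval d) = g j},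
    ?_, ?_⟩
  · intro S' hS' hcard
    obtain ⟨c, hc, hcp⟩ := hmeet S' hS' hcard true
    obtain ⟨d, hd, hdp⟩ := hmeet S' hS' hcard false
    have hcC := hSC (hS' hc)
    have hdC := hSC (hS' hd)
    refine ⟨P.part c, P.part_mem.mpr hcC, P.part d, P.part_mem.mpr hdC, ?_,
      ⟨c, mem_inter.mpr ⟨P.mem_part_self.mpr hcC, hc⟩⟩,
      ⟨d, mem_inter.mpr ⟨P.mem_part_self.mpr hdC, hd⟩⟩⟩
    intro heq
    have hcd : c ∈ P.part d := heq ▸ P.mem_part_self.mpr hcC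
    rw [hP d hdC, mem_filter] at hcd
    have h1 := congrArg p hcd.2
    simp only [Function.comp_apply, hgp] at h1
    rw [hcp, hdp] at h1
    exact absurd h1 (by decide)
  · exact DecisionTree.depth_bind_le (d := 0) (fun _ => le_rfl) t
  · intro c hc
    rw [DecisionTree.eval_bind, hP c hc]
    rfl

/-- The labels pair the side of a balanced split of `S` with the survivors of the greedy tree. The
first component keeps `S` spread, the second one ensures that at least `k` labels occur. -/
theorem exists_finpartition_spread_tree {n : ℕ} {C S : Finset (Concept n)} {k D : ℕ} (hk : 2 ≤ k)
    (hkC : k ≤ #C) (hSC : S ⊆ C) (hS : 2 ≤ #S) (hγ : gammaHat C ≤ 1)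
    (hD : (1 - gammaHat C) ^ D ≤ 1 / k) :
    ∃ P : Finpartition C, #P.parts = k ∧ S ∈ spreadSubsets P ∧
      ∃ t : DecisionTree n (Finset (Concept n)), t.depth ≤ 2 * D ∧
        ∀ c ∈ C, t.eval c = P.part c := by
  have hk' : (2 : ℝ) ≤ k := by exact_mod_cast hk
  have hk0 : (0 : ℝ) < k := by linarith
  have hkC' : (k : ℝ) ≤ #C := by exact_mod_cast hkC
  obtain ⟨t₁, ht₁, hsplit⟩ := exists_tree_balanced_split (L := D) hS
    (fun U hU h2 => exists_gammaHat_le_gammaAt (hU.trans hSC) h2)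
    (hD.trans (one_div_le_one_div_of_le (by norm_num) hk'))
  obtain ⟨t₂, ht₂, hsmall⟩ := exists_tree_card_eval_le hγ D C
    (fun U hU h2 => exists_gammaHat_le_gammaAt hU h2)
  -- every label is a set of at most `#C / k` concepts, so there are at least `k` labels
  have hlabel : ∀ c ∈ C, (#(t₂.eval c) : ℝ) ≤ #C / k := by
    intro c hc
    refine (hsmall c hc).2.trans (max_le ?_ ?_)
    · rwa [le_div_iff₀ hk0, one_mul]
    · calc _ ≤ 1 / (k : ℝ) * #C := mul_le_mul_of_nonneg_right hD (Nat.cast_nonneg _)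
        _ = _ := by ring
  have hcover : C ⊆ (C.image fun c => t₂.eval c).biUnion id := by
    intro c hc
    exact mem_biUnion.mpr ⟨_, mem_image_of_mem _ hc, (hsmall c hc).1⟩
  have hcard : (#C : ℝ) ≤ #(C.image fun c => t₂.eval c) * (#C / k) := by
    calc (#C : ℝ) ≤ #((C.image fun c => t₂.eval c).biUnion id) := by
          exact_mod_cast card_le_card hcover
      _ ≤ ∑ T ∈ C.image fun c => t₂.eval c, (#T : ℝ) := by exact_mod_cast card_biUnion_le
      _ ≤ ∑ T ∈ C.image fun c => t₂.eval c, (#C / k : ℝ) := by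
          refine sum_le_sum fun T hT => ?_
          obtain ⟨c, hc, rfl⟩ := mem_image.mp hT
          exact hlabel c hc
      _ = _ := by simp
  have hkle : k ≤ #(C.image fun c => t₂.eval c) := by
    have hC0 : (0 : ℝ) < #C := by linarith
    rw [mul_div_assoc', le_div_iff₀ hk0, mul_comm] at hcard
    exact_mod_cast le_of_mul_le_mul_right hcard hC0
  let t : DecisionTree n (Bool × Finset (Concept n)) :=
    t₁.bind fun b => t₂.bind fun T => .leaf (b, T)
  have heval : ∀ c, t.eval c = (t₁.eval c, t₂.eval c) := by
    intro c
    simp only [t, DecisionTree.eval_bind]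
    rfl
  have hdepth : t.depth ≤ 2 * D := by
    have h1 : t.depth ≤ t₁.depth + t₂.depth := DecisionTree.depth_bind_le
      (fun b => DecisionTree.depth_bind_le (d := 0) (fun _ => le_rfl) t₂) t₁
    omega
  obtain ⟨P, hP, hSP, t', ht', hlearn⟩ := exists_finpartition_of_tree hk hSC hS t Prod.fst
    (by simpa only [heval] using hsplit) (by
      refine hkle.trans ?_
      have himage : (C.image fun c => t₂.eval c) = (C.image fun c => t.eval c).image Prod.snd := by
        rw [image_image]
        exact image_congr fun c _ => by simp [heval]
      rw [himage]
      exact card_image_le)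
  exact ⟨P, hP, hSP, t', ht'.trans hdepth, hlearn⟩

theorem randomizedComplexity_le_depth {n : ℕ} {C : Finset (Concept n)} {P : Finpartition C}
    (t : DecisionTree n (Finset (Concept n))) (ht : ∀ c ∈ C, t.eval c = P.part c) :
    randomizedComplexity P ≤ t.depth := by
  refine Nat.sInf_le ⟨PMF.pure t, fun s hs => ?_, fun c hc => ?_⟩
  · rw [PMF.mem_support_pure_iff] at hs
    rw [hs]
  · rw [PMF.pure_map, ht c hc]
    simp only [PMF.pure_apply, if_true]
    exact ENNReal.div_le_of_le_mul (by norm_num)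

/-! ### Norms of quantum states -/

/-- The Euclidean norm of a vector of amplitudes (on a function type, `‖v‖` is the sup norm). -/
noncomputable abbrev l2norm {B : Type} [Fintype B] (v : B → ℂ) : ℝ := ‖WithLp.toLp 2 v‖

theorem l2norm_sq {B : Type} [Fintype B] (v : B → ℂ) : l2norm v ^ 2 = ∑ p, ‖v p‖ ^ 2 :=
  EuclideanSpace.norm_sq_eq _

theorem l2norm_add_le {B : Type} [Fintype B] (v w : B → ℂ) :
    l2norm (v + w) ≤ l2norm v + l2norm w := by
  simpa [l2norm, WithLp.toLp_add] using norm_add_le (WithLp.toLp 2 v) (WithLp.toLp 2 w)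

theorem l2norm_sub_le {B : Type} [Fintype B] (v w : B → ℂ) :
    l2norm (v - w) ≤ l2norm v + l2norm w := by
  simpa [l2norm, WithLp.toLp_sub] using norm_sub_le (WithLp.toLp 2 v) (WithLp.toLp 2 w)

theorem l2norm_mulVec {B : Type} [Fintype B] [DecidableEq B] {U : Matrix B B ℂ}
    (hU : U ∈ Matrix.unitaryGroup B ℂ) (v : B → ℂ) : l2norm (U.mulVec v) = l2norm v := by
  have key : ∀ w : B → ℂ, ((l2norm w ^ 2 : ℝ) : ℂ) = dotProduct (star w) w := by
    intro w
    rw [l2norm_sq, dotProduct]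
    push_cast
    refine sum_congr rfl fun p _ => ?_
    rw [Pi.star_apply, ← starRingEnd_apply, Complex.conj_mul']
  have h : ((l2norm (U.mulVec v) ^ 2 : ℝ) : ℂ) = ((l2norm v ^ 2 : ℝ) : ℂ) := by
    rw [key, key, Matrix.star_mulVec, Matrix.dotProduct_mulVec, Matrix.vecMul_vecMul,
      ← Matrix.star_eq_conjTranspose, Matrix.mem_unitaryGroup_iff'.mp hU, Matrix.vecMul_one]
  exact (sq_eq_sq₀ (norm_nonneg _) (norm_nonneg _)).mp (by exact_mod_cast h)

theorem l2norm_single {B : Type} [Fintype B] [DecidableEq B] (p : B) :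
    l2norm (Pi.single p (1 : ℂ)) = 1 := by
  rw [← sq_eq_sq₀ (norm_nonneg _) zero_le_one, l2norm_sq, sum_eq_single p] <;> simp +contextual

/-- Deleting the amplitudes outside `F` does not increase the norm. -/
theorem sum_le_l2norm_sq {B : Type} [Fintype B] (F : Finset B) (v : B → ℂ) :
    ∑ p ∈ F, ‖v p‖ ^ 2 ≤ l2norm v ^ 2 := by
  rw [l2norm_sq]
  exact sum_le_sum_of_subset_of_nonneg (subset_univ _) fun _ _ _ => by positivity

theorem sqrt_sum_le_add {B : Type} [Fintype B] (F : Finset B) (v w : B → ℂ) :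
    √(∑ p ∈ F, ‖v p‖ ^ 2) ≤ √(∑ p ∈ F, ‖w p‖ ^ 2) + l2norm (v - w) := by
  have h := norm_add_le (WithLp.toLp 2 fun p : F => w p) (WithLp.toLp 2 fun p : F => v p - w p)
  rw [← WithLp.toLp_add] at h
  have h1 : (fun p : F => w p) + (fun p : F => v p - w p) = fun p : F => v p := by
    ext p
    simp
  rw [h1, EuclideanSpace.norm_eq, EuclideanSpace.norm_eq, EuclideanSpace.norm_eq] at h
  simp only [sum_coe_sort F fun p => ‖v p‖ ^ 2, sum_coe_sort F fun p => ‖w p‖ ^ 2,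
    sum_coe_sort F fun p => ‖v p - w p‖ ^ 2] at h
  refine h.trans (add_le_add le_rfl ?_)
  exact Real.sqrt_le_iff.mpr ⟨norm_nonneg _, sum_le_l2norm_sq F (v - w)⟩

/-! ### The oracle -/

theorem oracle_mulVec_apply {n w : ℕ} (c : Concept n) (v : Basis n w → ℂ) (p : Basis n w) :
    (oracle w c).mulVec v p = v (p.1, xor p.2.1 (c p.1), p.2.2) := by
  rw [Matrix.mulVec, dotProduct, sum_eq_single (p.1, xor p.2.1 (c p.1), p.2.2)]
  · simp [oracle]
  · rintro ⟨x, b, z⟩ - hq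
    have : ¬ p = (x, xor b (c x), z) := by
      rintro rfl
      simp at hq
    simp [oracle, this]
  · simp

theorem oracle_mem_unitaryGroup {n : ℕ} (w : ℕ) (c : Concept n) :
    oracle w c ∈ Matrix.unitaryGroup (Basis n w) ℂ :=
  of_perm_mem_unitaryGroup (Function.Involutive.toPerm
    (fun q : Basis n w => (q.1, xor q.2.1 (c q.1), q.2.2)) (by rintro ⟨x, b, z⟩; simp))

/-- Two oracles differ only on the part of the state that queries a point where the concepts
disagree. -/
theorem l2norm_oracle_sub_oracle_le {n w : ℕ} (c m : Concept n) (v : Basis n w → ℂ) :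
    l2norm ((oracle w c).mulVec v - (oracle w m).mulVec v) ≤
      2 * √(∑ p with c p.1 ≠ m p.1, ‖v p‖ ^ 2) := by
  set u : Basis n w → ℂ := fun p => if c p.1 ≠ m p.1 then v p else 0 with hu
  have h1 : (oracle w c).mulVec v - (oracle w m).mulVec v =
      (oracle w c).mulVec u - (oracle w m).mulVec u := by
    ext p
    simp only [Pi.sub_apply, oracle_mulVec_apply, hu]
    by_cases hp : c p.1 = m p.1 <;> simp [hp]
  have h2 : l2norm u = √(∑ p with c p.1 ≠ m p.1, ‖v p‖ ^ 2) := by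
    rw [l2norm, EuclideanSpace.norm_eq, sum_filter]
    congr 1
    refine sum_congr rfl fun p _ => ?_
    by_cases hp : c p.1 = m p.1 <;> simp [hu, hp]
  rw [h1, ← h2, two_mul]
  refine (l2norm_sub_le _ _).trans ?_
  rw [l2norm_mulVec (oracle_mem_unitaryGroup w c), l2norm_mulVec (oracle_mem_unitaryGroup w m)]

namespace QuantumAlgorithm

theorem l2norm_state {n : ℕ} {α : Type} (A : QuantumAlgorithm n α) (c : Concept n) (i : ℕ) :
    l2norm (A.state c i) = 1 := by
  induction i with
  | zero => rw [state, l2norm_mulVec (A.U 0).2, l2norm_single]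
  | succ i ih =>
    rw [state, l2norm_mulVec (A.U (i + 1)).2, l2norm_mulVec (oracle_mem_unitaryGroup _ c), ih]

/-! ### The hybrid argument -/

theorem l2norm_state_sub_state_le {n : ℕ} {α : Type} (A : QuantumAlgorithm n α)
    (c m : Concept n) (i : ℕ) :
    l2norm (A.state c i - A.state m i) ≤
      ∑ j ∈ range i, 2 * √(∑ p with c p.1 ≠ m p.1, ‖A.state m j p‖ ^ 2) := by
  induction i with
  | zero => simp [state]
  | succ i ih =>
    rw [state, state, ← Matrix.mulVec_sub, l2norm_mulVec (A.U (i + 1)).2, sum_range_succ]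
    have h : (oracle A.workspace c).mulVec (A.state c i) - (oracle A.workspace m).mulVec
        (A.state m i) = (oracle A.workspace c).mulVec (A.state c i - A.state m i) +
        ((oracle A.workspace c).mulVec (A.state m i) -
          (oracle A.workspace m).mulVec (A.state m i)) := by
      rw [Matrix.mulVec_sub]
      abel
    rw [h]
    refine (l2norm_add_le _ _).trans (add_le_add ?_ (l2norm_oracle_sub_oracle_le c m _))
    rwa [l2norm_mulVec (oracle_mem_unitaryGroup _ c)]

/-- If every query distinguishes `m` from at most a `γ` fraction of `S`, then `T` queries move
the final state, in mean square over `S`, by at most `2 T √γ`. -/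
theorem sum_l2norm_state_sub_state_sq_le {n : ℕ} {α : Type} (A : QuantumAlgorithm n α)
    {S : Finset (Concept n)} {m : Concept n} {γ : ℝ}
    (hm : ∀ x, (#{c ∈ S | c x ≠ m x} : ℝ) ≤ γ * #S) (i : ℕ) :
    ∑ c ∈ S, l2norm (A.state c i - A.state m i) ^ 2 ≤ 4 * i ^ 2 * γ * #S := by
  have hstep : ∀ j, ∑ c ∈ S, ∑ p with c p.1 ≠ m p.1, ‖A.state m j p‖ ^ 2 ≤ γ * #S := by
    intro j
    calc ∑ c ∈ S, ∑ p with c p.1 ≠ m p.1, ‖A.state m j p‖ ^ 2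
        = ∑ p, #{c ∈ S | c p.1 ≠ m p.1} * ‖A.state m j p‖ ^ 2 := by
          simp only [sum_filter]
          rw [sum_comm]
          refine sum_congr rfl fun p _ => ?_
          rw [← sum_filter, sum_const, nsmul_eq_mul]
      _ ≤ ∑ p, γ * #S * ‖A.state m j p‖ ^ 2 :=
          sum_le_sum fun p _ => mul_le_mul_of_nonneg_right (hm p.1) (by positivity)
      _ = γ * #S := by
          rw [← mul_sum, ← l2norm_sq, l2norm_state]
          ring
  calc ∑ c ∈ S, l2norm (A.state c i - A.state m i) ^ 2
      ≤ ∑ c ∈ S, i * ∑ j ∈ range i, 4 * ∑ p with c p.1 ≠ m p.1, ‖A.state m j p‖ ^ 2 := by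
        refine sum_le_sum fun c _ => ?_
        refine (pow_le_pow_left₀ (norm_nonneg _) (A.l2norm_state_sub_state_le c m i) 2).trans ?_
        refine sq_sum_le_card_mul_sum_sq.trans (le_of_eq ?_)
        rw [card_range]
        congr 1
        refine sum_congr rfl fun j _ => ?_
        rw [mul_pow, Real.sq_sqrt (sum_nonneg fun _ _ => by positivity)]
        norm_num
    _ = i * ∑ j ∈ range i, 4 * ∑ c ∈ S, ∑ p with c p.1 ≠ m p.1, ‖A.state m j p‖ ^ 2 := by
        rw [← mul_sum, sum_comm]
        simp only [mul_sum]
    _ ≤ i * ∑ j ∈ range i, 4 * (γ * #S) := by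
        gcongr with j _
        exact hstep j
    _ = 4 * i ^ 2 * γ * #S := by
        rw [sum_const, card_range, nsmul_eq_mul]
        ring

/-- Final states at distance less than `1 / 5` cannot lead to different outputs, each with
probability `2 / 3`. -/
theorem le_l2norm_sub_of_outputProb {n : ℕ} {α : Type} [DecidableEq α] (A : QuantumAlgorithm n α)
    {c d : Concept n} {a b : α} (hab : a ≠ b) (hc : 2 / 3 ≤ A.outputProb c a)
    (hd : 2 / 3 ≤ A.outputProb d b) :
    1 / 5 ≤ l2norm (A.state c A.queries - A.state d A.queries) := by
  have hsum : A.outputProb d a + A.outputProb d b ≤ 1 := by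
    have h1 : (1 : ℝ) = l2norm (A.state d A.queries) ^ 2 := by rw [l2norm_state, one_pow]
    rw [h1, outputProb, outputProb, ← sum_union]
    · exact sum_le_l2norm_sq _ _
    · rw [disjoint_left]
      intro p hpa hpb
      exact hab ((mem_filter.mp hpa).2.symm.trans (mem_filter.mp hpb).2)
  have h := sqrt_sum_le_add {p | A.output p = a} (A.state c A.queries) (A.state d A.queries)
  change √(A.outputProb c a) ≤ √(A.outputProb d a) + _ at h
  have h1 : (4 / 5 : ℝ) ≤ √(A.outputProb c a) := Real.le_sqrt_of_sq_le (by linarith)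
  have h2 : √(A.outputProb d a) ≤ 3 / 5 := Real.sqrt_le_iff.mpr ⟨by norm_num, by linarith⟩
  linarith

/-! ### The dimension bound -/

/-- After `i` queries the states for all concepts together lie in a space of dimension at most
`(2 ^ (n + 1)) ^ i`: the oracle is a sum, over query points `x`, of operators depending on the
concept only through its value at `x`. -/
theorem exists_span_states {n : ℕ} {α : Type} (A : QuantumAlgorithm n α) (i : ℕ) :
    ∃ s : Finset (Basis n A.workspace → ℂ), #s ≤ (2 ^ n * 2) ^ i ∧
      ∀ c, A.state c i ∈ Submodule.span ℂ (s : Set (Basis n A.workspace → ℂ)) := by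
  classical
  induction i with
  | zero =>
    exact ⟨{A.state (fun _ => false) 0}, by simp, fun c => Submodule.subset_span (by simp [state])⟩
  | succ i ih =>
    obtain ⟨s, hs, hspan⟩ := ih
    let R : Input n × Bool → (Basis n A.workspace → ℂ) →ₗ[ℂ] (Basis n A.workspace → ℂ) := fun q =>
      { toFun := fun v p => if p.1 = q.1 then v (p.1, xor p.2.1 q.2, p.2.2) else 0
        map_add' := by
          intro u v
          ext p
          by_cases hp : p.1 = q.1 <;> simp [hp]
        map_smul' := by
          intro r v
          ext p
          by_cases hp : p.1 = q.1 <;> simp [hp] }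
    let M : Input n × Bool → (Basis n A.workspace → ℂ) →ₗ[ℂ] (Basis n A.workspace → ℂ) := fun q =>
      (A.U (i + 1) : Matrix _ _ ℂ).mulVecLin ∘ₗ R q
    refine ⟨((univ : Finset (Input n × Bool)) ×ˢ s).image fun q => M q.1 q.2, ?_, fun c => ?_⟩
    · refine card_image_le.trans ?_
      rw [card_product, card_univ, pow_succ', Fintype.card_prod]
      refine Nat.mul_le_mul (le_of_eq ?_) hs
      simp
    · have horacle : (oracle A.workspace c).mulVec (A.state c i) =
          ∑ x, R (x, c x) (A.state c i) := by
        ext p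
        simp [R, oracle_mulVec_apply]
      have hstate : A.state c (i + 1) = ∑ x, M (x, c x) (A.state c i) := by
        rw [state, horacle]
        exact map_sum (Matrix.mulVecLin (A.U (i + 1)).1) _ _
      rw [hstate]
      refine Submodule.sum_mem _ fun x _ => ?_
      have hmap := Submodule.mem_map_of_mem (f := M (x, c x)) (hspan c)
      rw [Submodule.map_span] at hmap
      refine Submodule.span_mono ?_ hmap
      rintro _ ⟨v, hv, rfl⟩
      rw [mem_coe, mem_image]
      exact ⟨((x, c x), v), by simpa using hv, rfl⟩

end QuantumAlgorithm

/-- Unit vectors `v i` of a `d`-dimensional space, measured in the standard basis, give their own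
label `i` with total probability at most `d`: the probability of the outcome `p` is at most
the squared norm of the projection of `p` to the space, and these squared norms add up to `d`. -/
theorem sum_sum_norm_sq_le_card {B ι : Type} [Fintype B] [DecidableEq ι] (s : Finset (B → ℂ))
    (I : Finset ι) (f : B → ι) (v : ι → B → ℂ) (hv : ∀ i, l2norm (v i) = 1)
    (hs : ∀ i, v i ∈ Submodule.span ℂ (s : Set (B → ℂ))) :
    ∑ i ∈ I, ∑ p with f p = i, ‖v i p‖ ^ 2 ≤ #s := by
  classical
  let V : Submodule ℂ (EuclideanSpace ℂ B) :=
    Submodule.span ℂ ((s.image fun u => WithLp.toLp 2 u : Finset (EuclideanSpace ℂ B)) : Set _)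
  have hV : Module.finrank ℂ V ≤ #s := (finrank_span_finset_le_card _).trans card_image_le
  have hmem : ∀ i, WithLp.toLp 2 (v i) ∈ V := by
    intro i
    have h := Submodule.mem_map_of_mem
      (f := ((WithLp.linearEquiv 2 ℂ (B → ℂ)).symm : (B → ℂ) →ₗ[ℂ] EuclideanSpace ℂ B)) (hs i)
    rw [Submodule.map_span] at h
    refine Submodule.span_mono ?_ h
    rw [coe_image]
    exact le_rfl
  let e := stdOrthonormalBasis ℂ V
  -- Cauchy–Schwarz in coordinates with respect to an orthonormal basis of `V`
  have hpt : ∀ i p, ‖v i p‖ ^ 2 ≤ ∑ j, ‖(e j : EuclideanSpace ℂ B) p‖ ^ 2 := by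
    intro i p
    set u : V := ⟨WithLp.toLp 2 (v i), hmem i⟩ with hu
    have hexp : v i p = ∑ j, e.repr u j * (e j : EuclideanSpace ℂ B) p := by
      have h := congrArg (fun z : V => (z : EuclideanSpace ℂ B) p) (e.sum_repr u)
      simpa [hu] using h.symm
    have hnorm : ∑ j, ‖e.repr u j‖ ^ 2 = 1 := by
      rw [← EuclideanSpace.norm_sq_eq, e.repr.norm_map]
      have : ‖u‖ = l2norm (v i) := rfl
      rw [this, hv, one_pow]
    rw [hexp]
    calc ‖∑ j, e.repr u j * (e j : EuclideanSpace ℂ B) p‖ ^ 2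
        ≤ (∑ j, ‖e.repr u j‖ * ‖(e j : EuclideanSpace ℂ B) p‖) ^ 2 := by
          refine pow_le_pow_left₀ (norm_nonneg _) ((norm_sum_le _ _).trans (le_of_eq ?_)) 2
          simp only [norm_mul]
      _ ≤ (∑ j, ‖e.repr u j‖ ^ 2) * ∑ j, ‖(e j : EuclideanSpace ℂ B) p‖ ^ 2 :=
          sum_mul_sq_le_sq_mul_sq _ _ _
      _ = _ := by rw [hnorm, one_mul]
  calc ∑ i ∈ I, ∑ p with f p = i, ‖v i p‖ ^ 2
      ≤ ∑ i ∈ I, ∑ p with f p = i, ∑ j, ‖(e j : EuclideanSpace ℂ B) p‖ ^ 2 :=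
        sum_le_sum fun i _ => sum_le_sum fun p _ => hpt i p
    _ ≤ ∑ p, ∑ j, ‖(e j : EuclideanSpace ℂ B) p‖ ^ 2 := by
          rw [← sum_biUnion]
          · exact sum_le_sum_of_subset_of_nonneg (subset_univ _)
              fun _ _ _ => sum_nonneg fun _ _ => by positivity
          · intro i _ i' _ hii'
            rw [Function.onFun, disjoint_left]
            intro p hp hp'
            exact hii' ((mem_filter.mp hp).2.symm.trans (mem_filter.mp hp').2)
    _ = ∑ j, ‖(e j : EuclideanSpace ℂ B)‖ ^ 2 := by
        rw [sum_comm]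
        simp only [EuclideanSpace.norm_sq_eq]
    _ = Module.finrank ℂ V := by
        have h1 : ∀ j, ‖(e j : EuclideanSpace ℂ B)‖ = 1 := fun j => e.norm_eq_one j
        simp [h1]
    _ ≤ #s := by exact_mod_cast hV

/-! ### Lower bounds for quantum learning -/

/-- One representative of each piece is identified with probability `2 / 3` by final states in a
space of dimension `(2 ^ (n + 1)) ^ T`. -/
theorem QuantumLearns.card_parts_le {n : ℕ} {C : Finset (Concept n)} {P : Finpartition C} {T : ℕ}
    (h : QuantumLearns P T) : (2 / 3 : ℝ) * #P.parts ≤ (2 ^ n * 2) ^ T := by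
  obtain ⟨A, rfl, hA⟩ := h
  obtain ⟨s, hs, hspan⟩ := A.exists_span_states A.queries
  have hrep : ∀ B : Finset (Concept n), ∃ c, B ∈ P.parts → c ∈ C ∧ P.part c = B := by
    intro B
    by_cases hB : B ∈ P.parts
    · obtain ⟨c, hc⟩ := P.nonempty_of_mem_parts hB
      exact ⟨c, fun _ => ⟨P.subset hB hc, P.part_eq_of_mem hB hc⟩⟩
    · exact ⟨fun _ => false, fun h => absurd h hB⟩
  choose r hr using hrep
  have h1 := sum_sum_norm_sq_le_card s P.parts A.output (fun B => A.state (r B) A.queries)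
    (fun B => A.l2norm_state _ _) (fun B => hspan _)
  have h2 : ∑ B ∈ P.parts, (2 / 3 : ℝ) ≤
      ∑ B ∈ P.parts, ∑ p with A.output p = B, ‖A.state (r B) A.queries p‖ ^ 2 := by
    refine sum_le_sum fun B hB => ?_
    have h3 := hA (r B) (hr B hB).1
    rwa [(hr B hB).2] at h3
  rw [sum_const, nsmul_eq_mul, mul_comm] at h2
  exact h2.trans (h1.trans (by exact_mod_cast hs))

/-- The constant `6` absorbs both the success probability, through `k ≤ (2 k / 3) ^ 3` for `k ≥ 2`,
and `log (2 ^ (n + 1)) ≤ 2 n`. -/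
theorem QuantumLearns.log_card_parts_le {n : ℕ} (hn : 1 ≤ n) {C : Finset (Concept n)}
    {P : Finpartition C} {T : ℕ} (hP : 2 ≤ #P.parts) (h : QuantumLearns P T) :
    Real.log #P.parts ≤ 6 * n * T := by
  have hk : (2 : ℝ) ≤ #P.parts := by exact_mod_cast hP
  have hn' : (1 : ℝ) ≤ n := by exact_mod_cast hn
  set k : ℝ := (#P.parts : ℝ)
  have h1 : k ≤ (2 / 3 * k) ^ 3 := by
    nlinarith [mul_nonneg (by linarith : 0 ≤ k - 2) (by linarith : 0 ≤ k)]
  have h2 : k ≤ ((2 ^ n * 2) ^ T) ^ 3 :=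
    h1.trans (pow_le_pow_left₀ (by linarith) h.card_parts_le 3)
  have h3 := Real.log_le_log (by linarith) h2
  rw [← pow_succ, Real.log_pow, Real.log_pow, Real.log_pow] at h3
  push_cast at h3
  have hlog : Real.log 2 ≤ 1 := by linarith [Real.log_two_lt_d9]
  have hlog0 : 0 ≤ Real.log 2 := Real.log_nonneg (by norm_num)
  refine h3.trans ?_
  have h4 : ((n : ℝ) + 1) * Real.log 2 ≤ 2 * n := by nlinarith
  have h5 : (T : ℝ) * (((n : ℝ) + 1) * Real.log 2) ≤ T * (2 * n) :=
    mul_le_mul_of_nonneg_left h4 (Nat.cast_nonneg _)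
  linarith

/-- The majority vote of `S` is hard to tell from the members of `S`: each query does so for at most
a `gamma S` fraction. -/
theorem exists_majority {n : ℕ} (S : Finset (Concept n)) :
    ∃ m : Concept n, ∀ x, (#{c ∈ S | c x ≠ m x} : ℝ) ≤ gamma S * #S := by
  have key : ∀ x : Input n, ∃ b : Bool, (#{c ∈ S | c x ≠ b} : ℝ) ≤ gamma S * #S := by
    intro x
    rcases S.eq_empty_or_nonempty with rfl | hS
    · exact ⟨true, by simp⟩
    have hS' : (0 : ℝ) < #S := by exact_mod_cast hS.card_pos
    obtain ⟨b, -, hb⟩ := exists_mem_eq_inf' (univ_nonempty (α := Bool))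
      fun b : Bool => (#{c ∈ S | c x = b} : ℝ) / (#S : ℝ)
    refine ⟨!b, ?_⟩
    have h1 := gammaAt_le_gamma S x
    rw [gammaAt, hb, div_le_iff₀ hS'] at h1
    simpa using h1
  choose m hm using key
  exact ⟨m, hm⟩

/-- Most members of a spread set end near the final state of its majority vote, hence near each
other, although some two of them must be told apart. -/
theorem QuantumLearns.le_sq_mul_gamma {n : ℕ} {C S : Finset (Concept n)} {P : Finpartition C}
    {T : ℕ} (hS : S ∈ spreadSubsets P) (h : QuantumLearns P T) :
    1 / 1600 ≤ (T : ℝ) ^ 2 * gamma S := by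
  obtain ⟨A, rfl, hA⟩ := h
  obtain ⟨hSC, hS2, hspread⟩ := hS
  obtain ⟨m, hm⟩ := exists_majority S
  by_contra! hlt
  have hS0 : (0 : ℝ) < #S := by exact_mod_cast (by omega : 0 < #S)
  set δ : Concept n → ℝ := fun c => l2norm (A.state c A.queries - A.state m A.queries) with hδ
  have hsum : ∑ c ∈ S, δ c ^ 2 ≤ 4 * (A.queries : ℝ) ^ 2 * gamma S * #S :=
    A.sum_l2norm_state_sub_state_sq_le hm A.queries
  -- Markov's inequality: fewer than a quarter of the concepts end far from the majority vote
  have hfar : (#{c ∈ S | ¬ δ c < 1 / 10} : ℝ) * (1 / 100) ≤ ∑ c ∈ S, δ c ^ 2 := by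
    calc (#{c ∈ S | ¬ δ c < 1 / 10} : ℝ) * (1 / 100)
        = ∑ c ∈ S with ¬ δ c < 1 / 10, (1 / 100 : ℝ) := by rw [sum_const, nsmul_eq_mul]
      _ ≤ ∑ c ∈ S with ¬ δ c < 1 / 10, δ c ^ 2 := by
          refine sum_le_sum fun c hc => ?_
          have h1 := (mem_filter.mp hc).2
          nlinarith
      _ ≤ ∑ c ∈ S, δ c ^ 2 := sum_le_sum_of_subset_of_nonneg (filter_subset _ _)
          fun _ _ _ => by positivity
  have hcard : (#{c ∈ S | δ c < 1 / 10} : ℝ) + #{c ∈ S | ¬ δ c < 1 / 10} = #S := by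
    exact_mod_cast card_filter_add_card_filter_not (s := S) fun c => δ c < 1 / 10
  have hnear : (3 / 4 : ℝ) * #S ≤ #{c ∈ S | δ c < 1 / 10} := by nlinarith
  obtain ⟨B, hB, B', hB', hne, ⟨c, hc⟩, ⟨d, hd⟩⟩ := hspread _ (filter_subset _ _) hnear
  rw [mem_inter, mem_filter] at hc hd
  have h1 := hA c (hSC hc.2.1)
  have h2 := hA d (hSC hd.2.1)
  rw [P.part_eq_of_mem hB hc.1] at h1
  rw [P.part_eq_of_mem hB' hd.1] at h2
  have h3 := A.le_l2norm_sub_of_outputProb hne h1 h2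
  have h4 := l2norm_sub_le (A.state c A.queries - A.state m A.queries)
    (A.state d A.queries - A.state m A.queries)
  rw [sub_sub_sub_cancel_right] at h4
  have h5 : δ c < 1 / 10 := hc.2.2
  have h6 : δ d < 1 / 10 := hd.2.2
  simp only [hδ] at h5 h6
  linarith

theorem quantumLearns_quantumComplexity {n : ℕ} {C : Finset (Concept n)} (P : Finpartition C) :
    QuantumLearns P (quantumComplexity P) :=
  Nat.sInf_mem (exists_quantumLearns P)

end PartitionLearning

/-! ### Choosing the partition and comparing the bounds -/

theorem mainTheorem4 :
    ∃ K : ℝ, 0 < K ∧ ∃ κ : ℝ, 0 < κ ∧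
      ∀ (n : ℕ) (_ : 1 ≤ n) (C : Finset (PartitionLearning.Concept n)) (k : ℕ)
        (_ : 2 ≤ k) (_ : k ≤ C.card),
        ∃ P : Finpartition C, P.parts.card = k ∧
          (PartitionLearning.randomizedComplexity P : ℝ) ≤
            K * ((n : ℝ) * (PartitionLearning.quantumComplexity P : ℝ) ^ 3) ∧
          PartitionLearning.gammaHatPart P = PartitionLearning.gammaHat C ∧
          (∃ t : PartitionLearning.DecisionTree n (Finset (PartitionLearning.Concept n)),
            (t.depth : ℝ) ≤
              K * (Real.log (P.parts.card : ℝ) / PartitionLearning.gammaHat C) ∧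
            ∀ c ∈ C, t.eval c = P.part c) ∧
          (PartitionLearning.randomizedComplexity P : ℝ) ≤
            K * (Real.log (P.parts.card : ℝ) / PartitionLearning.gammaHat C) ∧
          κ * (Real.log (P.parts.card : ℝ) / (n : ℝ) +
              1 / Real.sqrt (PartitionLearning.gammaHat C)) ≤
            (PartitionLearning.quantumComplexity P : ℝ) := by
  open PartitionLearning in
  refine ⟨38400, by norm_num, 1 / 46, by norm_num, fun n hn C k hk hkC => ?_⟩
  obtain ⟨S, hSC, hS2, hSγ⟩ := exists_gamma_eq_gammaHat (hk.trans hkC)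
  have hγ0 : 0 < gammaHat C := hSγ ▸ gamma_pos hS2
  have hγh : gammaHat C ≤ 1 / 2 := hSγ ▸ gamma_le_half S
  have hk' : (2 : ℝ) ≤ k := by exact_mod_cast hk
  have hn0 : (0 : ℝ) < n := by exact_mod_cast hn
  have hlog : 1 / 2 ≤ Real.log k := by
    have := Real.log_le_log (by norm_num) hk'
    linarith [Real.log_two_gt_d9]
  -- `(1 - γ) ^ D ≤ exp (-γ D) ≤ 1 / k`
  set D : ℕ := ⌈Real.log k / gammaHat C⌉₊ with hD
  have hDge : Real.log k / gammaHat C ≤ D := Nat.le_ceil _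
  have hpow : (1 - gammaHat C) ^ D ≤ 1 / (k : ℝ) := by
    calc (1 - gammaHat C) ^ D ≤ Real.exp (-gammaHat C) ^ D :=
          pow_le_pow_left₀ (by linarith) (by linarith [Real.add_one_le_exp (-gammaHat C)]) D
      _ = Real.exp (-(D * gammaHat C)) := by rw [← Real.exp_nat_mul]; ring_nf
      _ ≤ Real.exp (-Real.log k) := by
          rw [div_le_iff₀ hγ0] at hDge
          exact Real.exp_le_exp.mpr (by linarith)
      _ = 1 / (k : ℝ) := by rw [Real.exp_neg, Real.exp_log (by linarith), one_div]
  obtain ⟨P, hPk, hSP, t, htd, ht⟩ :=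
    exists_finpartition_spread_tree hk hkC hSC hS2 (by linarith) hpow
  have hQ := quantumLearns_quantumComplexity P
  have hlogQ := hQ.log_card_parts_le hn (hPk ▸ hk)
  have hγQ := hQ.le_sq_mul_gamma hSP
  rw [hSγ] at hγQ
  rw [hPk] at hlogQ
  set Q : ℝ := (quantumComplexity P : ℝ)
  have hQ0 : 0 ≤ Q := Nat.cast_nonneg _
  have hx1 : 1 ≤ Real.log k / gammaHat C := by
    rw [le_div_iff₀ hγ0]
    linarith
  have hdepth : (t.depth : ℝ) ≤ 4 * (Real.log k / gammaHat C) := by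
    have h1 : (t.depth : ℝ) ≤ 2 * D := by exact_mod_cast htd
    have h2 : (D : ℝ) < Real.log k / gammaHat C + 1 := Nat.ceil_lt_add_one (by linarith)
    linarith
  have hR : (randomizedComplexity P : ℝ) ≤ 4 * (Real.log k / gammaHat C) :=
    le_trans (by exact_mod_cast randomizedComplexity_le_depth t ht) hdepth
  refine ⟨P, hPk, ?_, gammaHatPart_eq_gammaHat hSP hSγ, ⟨t, ?_, ht⟩, ?_, ?_⟩
  · have h1 : 1 / gammaHat C ≤ 1600 * Q ^ 2 := by
      rw [div_le_iff₀ hγ0]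
      linarith
    have h2 : Real.log k / gammaHat C ≤ 6 * n * Q * (1600 * Q ^ 2) := by
      rw [div_eq_mul_one_div]
      exact mul_le_mul hlogQ h1 (by positivity) (by positivity)
    calc (randomizedComplexity P : ℝ) ≤ 4 * (Real.log k / gammaHat C) := hR
      _ ≤ 4 * (6 * n * Q * (1600 * Q ^ 2)) := by linarith
      _ = 38400 * (n * Q ^ 3) := by ring
  · rw [hPk]
    linarith
  · rw [hPk]
    linarith
  · rw [hPk]
    have h1 : Real.log k / n ≤ 6 * Q := by
      rw [div_le_iff₀ hn0]
      linarith
    have hs0 : 0 < √(gammaHat C) := Real.sqrt_pos.mpr hγ0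
    have h2 : 1 / √(gammaHat C) ≤ 40 * Q := by
      rw [div_le_iff₀ hs0]
      have h3 : (1 : ℝ) ^ 2 ≤ (40 * Q * √(gammaHat C)) ^ 2 := by
        rw [mul_pow, Real.sq_sqrt hγ0.le]
        linarith
      exact (pow_le_pow_iff_left₀ zero_le_one (by positivity) two_ne_zero).mp h3
    linarith
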